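/- Let $n=p+q\ge 3$, let $\varepsilon_i=1$ for $1\le i\le p$ and $\varepsilon_i=-1$ for $p<i\le n$, and let $\mathbb R^{p+1,q+1}$ have the basis $e_0,\dots,e_{n+1}$ and the inner product with $\langle e_0,e_{n+1}\rangle=\langle e_{n+1},e_0\rangle=1$, $\langle e_i,e_i\rangle=\varepsilon_i$ for $1\le i\le n$, all other products of basis vectors being $0$. Let $G=SO(p+1,q+1)$, let $P\subset G$ be the stabiliser of the ray $\mathbb R_{>0}e_0$, and let $\mathfrak g=\mathfrak{so}(p+1,q+1)=\mathfrak g_{-1}\oplus\mathfrak g_0\oplus\mathfrak g_1$ be the corresponding grading, where $\mathfrak g_{-1}\cong\mathbb R^n$: the element $X=(x_1,\dots,x_n)$ maps $e_0\mapsto\sum_i x_ie_i$, $e_i\mapsto-\varepsilon_ix_ie_{n+1}$ for $1\le i\le n$, $e_{n+1}\mapsto 0$. Let $M$ be a smooth manifold of dimension $n$ with an (oriented) conformal pseudo-Riemannian structure $[g]$ of signature $(p,q)$, let $(\pi:\mathcal G\to M,\omega)$ be its normal Cartan geometry of type $(G,P)$, and let $\mathcal TM=\mathcal G\times_P\mathbb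 R^{p+1,q+1}$ be the standard tractor bundle with its tractor connection. Let $u_0\in\mathcal G$. For $X\in\mathfrak g_{-1}$ let $\tilde X$ be the vector field on $\mathcal G$ with $\omega(\tilde X)=X$. Let $V\subset\mathfrak g_{-1}$ be an open neighbourhood of $0$, star-shaped about $0$, such that the flow line of $\tilde X$ through $u_0$ is defined up to time $1$ for all $X\in V$ and such that, with $\Phi(X)=\mathrm{Fl}^{\tilde X}_1(u_0)$, the map $\pi\circ\Phi$ is a diffeomorphism from $V$ onto an open set $U\subset M$. The inverse $U\to V$ is the normal chart; its components $x_1,\dots,x_n$ are the normal coordinates. The normal section $\sigma:U\to\mathcal G$ is given by $\sigma(\pi(\Phi(X)))=\Phi(X)$, and the normal frame $s_0,\dots,s_{n+1}$ of $\mathcal TM|_U$ by $s_a(x)=[\sigma(x),e_a]$. Then every section of $\mathcal TM|_U$ that is parallel for the tractor connection is a linear combination with constant real coefficients of the sections $$\tilde s_0=s_0-\sum_{i=1}^n x_is_i-\Bigl(\tfrac12\sum_{i=1}^n\varepsilon_ix_i^2\Bigr)s_{n+1},\qquad \tilde s_i=s_i+\varepsilon_ix_is_{n+1}\ (1\le i\le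 n),\qquad \tilde s_{n+1}=s_{n+1}.$$ -/

import Mathlib

open scoped Manifold ContDiff Matrix RightActions

noncomputable section

namespace ConformalTractor

/-! ### The algebra: signature, `𝔰𝔬(p+1,q+1)`, `SO(p+1,q+1)` and the parabolic subgroup -/

/-- Indices `0; 1, …, n; n+1` of the standard basis of `ℝ^{p+1,q+1}`, where `n = p + q`. -/
abbrev Idx (p q : ℕ) : Type := Fin 1 ⊕ (Fin (p + q) ⊕ Fin 1)

/-- The index `0`. -/
abbrev iFirst (p q : ℕ) : Idx p q := Sum.inl 0

/-- The indices `1, …, n`. -/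
abbrev iMid {p q : ℕ} (i : Fin (p + q)) : Idx p q := Sum.inr (Sum.inl i)

/-- The index `n+1`. -/
abbrev iLast (p q : ℕ) : Idx p q := Sum.inr (Sum.inr 0)

/-- The standard representation space `ℝ^{p+1,q+1}`. -/
abbrev StdRep (p q : ℕ) : Type := Idx p q → ℝ

/-- Square matrices of size `n+2`. -/
abbrev Mat (p q : ℕ) : Type := Matrix (Idx p q) (Idx p q) ℝ

/-- A matrix viewed as an element of the normed space of arrays of reals. -/
def entries {p q : ℕ} (A : Mat p q) : Idx p q → Idx p q → ℝ := fun a b => A a b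

/-- The standard basis `e_0, …, e_{n+1}` of `ℝ^{p+1,q+1}`. -/
def stdBasis {p q : ℕ} (a : Idx p q) : StdRep p q := Pi.single a 1

/-- `ε_i = 1` for the first `p` indices and `ε_i = -1` for the remaining `q`. -/
def eps {p q : ℕ} (i : Fin (p + q)) : ℝ := if (i : ℕ) < p then 1 else -1

/-- The Gram matrix of the inner product on `ℝ^{p+1,q+1}`: `⟨e_0, e_{n+1}⟩ = ⟨e_{n+1}, e_0⟩ = 1`,
`⟨e_i, e_i⟩ = ε_i` for `1 ≤ i ≤ n`, and all other products of basis vectors vanish. -/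
def gram (p q : ℕ) : Mat p q := fun a b =>
  match a, b with
  | Sum.inl _, Sum.inr (Sum.inr _) => 1
  | Sum.inr (Sum.inr _), Sum.inl _ => 1
  | Sum.inr (Sum.inl i), Sum.inr (Sum.inl j) => if i = j then eps i else 0
  | _, _ => 0

/-- The Lie algebra `𝔤 = 𝔰𝔬(p+1,q+1)`: matrices skew for the inner product `gram p q`. -/
abbrev LieAlg (p q : ℕ) : Submodule ℝ (Mat p q) := skewAdjointMatricesSubmodule (gram p q)

/-- The matrix of the element of `𝔤_{-1}` with components `x`. -/
def negMat {p q : ℕ} (x : Fin (p + q) → ℝ) : Mat p q := fun a b =>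
  match a, b with
  | Sum.inr (Sum.inl i), Sum.inl _ => x i
  | Sum.inr (Sum.inr _), Sum.inr (Sum.inl i) => -(eps i * x i)
  | _, _ => 0

/-- The matrix of the element of `𝔤_1` with components `z`. -/
def posMat {p q : ℕ} (z : Fin (p + q) → ℝ) : Mat p q := fun a b =>
  match a, b with
  | Sum.inl _, Sum.inr (Sum.inl i) => z i
  | Sum.inr (Sum.inl i), Sum.inr (Sum.inr _) => -(eps i * z i)
  | _, _ => 0

theorem eps_mul_eps {p q : ℕ} (i : Fin (p + q)) : eps i * eps i = 1 := by
  unfold eps; split_ifs <;> norm_num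

theorem mem_lieAlg {p q : ℕ} (A : Mat p q) :
    A ∈ LieAlg p q ↔ Aᵀ * gram p q = gram p q * (-A) := by
  rw [LieAlg, mem_skewAdjointMatricesSubmodule]
  rfl

theorem negMat_mem {p q : ℕ} (x : Fin (p + q) → ℝ) : negMat x ∈ LieAlg p q := by
  rw [mem_lieAlg]
  ext a b
  rcases a with a | a | a <;> rcases b with b | b | b <;>
    simp [Matrix.mul_apply, negMat, gram, Fintype.sum_sum_type, mul_comm]

theorem posMat_mem {p q : ℕ} (z : Fin (p + q) → ℝ) : posMat z ∈ LieAlg p q := by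
  rw [mem_lieAlg]
  ext a b
  rcases a with a | a | a <;> rcases b with b | b | b <;>
    simp [Matrix.mul_apply, posMat, gram, Fintype.sum_sum_type]
  · rw [← mul_assoc, eps_mul_eps, one_mul]
  · rw [mul_right_comm, eps_mul_eps, one_mul]

/-- The parametrisation of `𝔤_- = 𝔤_{-1}` by `ℝⁿ`. -/
def gNeg {p q : ℕ} (x : Fin (p + q) → ℝ) : LieAlg p q := ⟨negMat x, negMat_mem x⟩

/-- The parametrisation of `𝔤_1` by `ℝⁿ`. -/
def gPos {p q : ℕ} (z : Fin (p + q) → ℝ) : LieAlg p q := ⟨posMat z, posMat_mem z⟩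

/-- The component in `𝔤_{-1} ≅ ℝⁿ` of an element of `𝔤`, i.e. its class in `𝔤/𝔭 ≅ ℝⁿ`. -/
def negPart {p q : ℕ} (A : LieAlg p q) : Fin (p + q) → ℝ :=
  fun i => (A : Mat p q) (iMid i) (iFirst p q)

/-- The inner product of signature `(p,q)` on `ℝⁿ`. -/
def innerPQ {p q : ℕ} (x y : Fin (p + q) → ℝ) : ℝ := ∑ i, eps i * x i * y i

/-- The group `G = SO(p+1,q+1)`. -/
def SOGroup (p q : ℕ) : Subgroup (Matrix.SpecialLinearGroup (Idx p q) ℝ) where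
  carrier := {A | (A : Mat p q)ᵀ * gram p q * (A : Mat p q) = gram p q}
  one_mem' := by simp
  mul_mem' := by
    intro A B hA hB
    simp only [Set.mem_ofPred_eq, Matrix.SpecialLinearGroup.coe_mul, Matrix.transpose_mul] at *
    calc (B : Mat p q)ᵀ * (A : Mat p q)ᵀ * gram p q * ((A : Mat p q) * (B : Mat p q))
        = (B : Mat p q)ᵀ * ((A : Mat p q)ᵀ * gram p q * (A : Mat p q)) * (B : Mat p q) := by
          simp only [Matrix.mul_assoc]
      _ = gram p q := by rw [hA, hB]
  inv_mem' := by
    intro A hA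
    simp only [Set.mem_ofPred_eq] at *
    have h1 : (A : Mat p q) * ((A⁻¹ : Matrix.SpecialLinearGroup (Idx p q) ℝ) : Mat p q) = 1 := by
      rw [← Matrix.SpecialLinearGroup.coe_mul, mul_inv_cancel, Matrix.SpecialLinearGroup.coe_one]
    have h2 : ((A⁻¹ : Matrix.SpecialLinearGroup (Idx p q) ℝ) : Mat p q)ᵀ * (A : Mat p q)ᵀ = 1 := by
      rw [← Matrix.transpose_mul, h1, Matrix.transpose_one]
    calc ((A⁻¹ : Matrix.SpecialLinearGroup (Idx p q) ℝ) : Mat p q)ᵀ * gram p q *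
            ((A⁻¹ : Matrix.SpecialLinearGroup (Idx p q) ℝ) : Mat p q)
        = ((A⁻¹ : Matrix.SpecialLinearGroup (Idx p q) ℝ) : Mat p q)ᵀ *
            ((A : Mat p q)ᵀ * gram p q * (A : Mat p q)) *
            ((A⁻¹ : Matrix.SpecialLinearGroup (Idx p q) ℝ) : Mat p q) := by rw [hA]
      _ = (((A⁻¹ : Matrix.SpecialLinearGroup (Idx p q) ℝ) : Mat p q)ᵀ * (A : Mat p q)ᵀ) *
            gram p q *
            ((A : Mat p q) * ((A⁻¹ : Matrix.SpecialLinearGroup (Idx p q) ℝ) : Mat p q)) := by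
          simp only [Matrix.mul_assoc]
      _ = gram p q := by rw [h1, h2, Matrix.one_mul, Matrix.mul_one]

/-- The parabolic subgroup `P ⊆ G`: the stabiliser of the isotropic ray spanned by `e_0`. -/
def Parabolic (p q : ℕ) : Subgroup (Matrix.SpecialLinearGroup (Idx p q) ℝ) where
  carrier := {A | A ∈ SOGroup p q ∧ ∃ c : ℝ, 0 < c ∧
    (A : Mat p q) *ᵥ stdBasis (iFirst p q) = c • stdBasis (iFirst p q)}
  one_mem' := ⟨one_mem _, 1, one_pos, by simp⟩
  mul_mem' := by
    rintro A B ⟨hA, a, ha, hA'⟩ ⟨hB, b, hb, hB'⟩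
    refine ⟨mul_mem hA hB, b * a, mul_pos hb ha, ?_⟩
    rw [Matrix.SpecialLinearGroup.coe_mul, ← Matrix.mulVec_mulVec, hB', Matrix.mulVec_smul, hA',
      smul_smul]
  inv_mem' := by
    rintro A ⟨hA, a, ha, hA'⟩
    refine ⟨inv_mem hA, a⁻¹, inv_pos.mpr ha, ?_⟩
    have h1 : ((A⁻¹ : Matrix.SpecialLinearGroup (Idx p q) ℝ) : Mat p q) * (A : Mat p q) = 1 := by
      rw [← Matrix.SpecialLinearGroup.coe_mul, inv_mul_cancel, Matrix.SpecialLinearGroup.coe_one]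
    have h2 : stdBasis (iFirst p q) = a⁻¹ • ((A : Mat p q) *ᵥ stdBasis (iFirst p q)) := by
      rw [hA', smul_smul, inv_mul_cancel₀ ha.ne', one_smul]
    conv_lhs => rw [h2]
    rw [Matrix.mulVec_smul, Matrix.mulVec_mulVec, h1, Matrix.one_mulVec]

/-- The matrix of an element of `P`. -/
abbrev pMat {p q : ℕ} (b : Parabolic p q) : Mat p q := (b.1 : Mat p q)

/-- The Lie algebra `𝔭 ⊆ 𝔤` of `P`: the elements of `𝔤` preserving the line through `e_0`. -/
def IsParabolicElt {p q : ℕ} (A : LieAlg p q) : Prop :=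
  ∃ a : ℝ, (A : Mat p q) *ᵥ stdBasis (iFirst p q) = a • stdBasis (iFirst p q)

theorem IsParabolicElt.smul {p q : ℕ} {A : LieAlg p q} (hA : IsParabolicElt A) (t : ℝ) :
    IsParabolicElt (t • A) := by
  obtain ⟨a, ha⟩ := hA
  refine ⟨t * a, ?_⟩
  rw [Submodule.coe_smul, Matrix.smul_mulVec, ha, smul_smul]

theorem gram_mul_gram {p q : ℕ} : gram p q * gram p q = 1 := by
  ext a b
  rcases a with a | a | a <;> rcases b with b | b | b <;>
    simp only [Matrix.mul_apply, gram, Fintype.sum_sum_type, Matrix.one_apply] <;>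
    simp [Fin.fin_one_eq_zero]
  by_cases h : a = b
  · subst h; simp [eps_mul_eps]
  · simp [h]

theorem exp_orth {p q : ℕ} {A : Mat p q} (hA : Aᵀ * gram p q = gram p q * (-A)) :
    (NormedSpace.exp A)ᵀ * gram p q * NormedSpace.exp A = gram p q := by
  have hJ : IsUnit (gram p q) := IsUnit.of_mul_eq_one _ gram_mul_gram
  have hinv : (gram p q)⁻¹ = gram p q := Matrix.inv_eq_left_inv gram_mul_gram
  have hA' : Aᵀ = gram p q * (-A) * (gram p q)⁻¹ := by
    rw [← hA, hinv, Matrix.mul_assoc, gram_mul_gram, Matrix.mul_one]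
  rw [← Matrix.exp_transpose, hA', Matrix.exp_conj _ _ hJ, hinv,
    Matrix.mul_assoc _ (gram p q) (gram p q), gram_mul_gram, Matrix.mul_one, Matrix.mul_assoc,
    ← Matrix.exp_add_of_commute _ _ (Commute.neg_left (Commute.refl A)), neg_add_cancel,
    NormedSpace.exp_zero, Matrix.mul_one]

theorem det_exp_eq_one {p q : ℕ} {A : Mat p q} (hA : Aᵀ * gram p q = gram p q * (-A)) :
    (NormedSpace.exp A).det = 1 := by
  have hB : ((1 / 2 : ℝ) • A)ᵀ * gram p q = gram p q * (-((1 / 2 : ℝ) • A)) := by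
    rw [Matrix.transpose_smul, Matrix.smul_mul, hA, ← smul_neg, Matrix.mul_smul]
  have hsum : A = (1 / 2 : ℝ) • A + (1 / 2 : ℝ) • A := by
    rw [← add_smul]; norm_num
  have h := congrArg Matrix.det (exp_orth hB)
  have hg : (gram p q).det ≠ 0 := by
    intro h0
    have := congrArg Matrix.det (gram_mul_gram (p := p) (q := q))
    rw [Matrix.det_mul, h0, Matrix.det_one] at this
    norm_num at this
  rw [Matrix.det_mul, Matrix.det_mul, Matrix.det_transpose] at h
  rw [hsum, Matrix.exp_add_of_commute _ _ (Commute.refl _), Matrix.det_mul]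
  apply mul_right_cancel₀ hg
  linarith

theorem exp_mulVec_eigen {p q : ℕ} {A : Mat p q} {v : StdRep p q} {a : ℝ} (h : A *ᵥ v = a • v) :
    NormedSpace.exp A *ᵥ v = Real.exp a • v := by
  have hpow : ∀ k : ℕ, (A ^ k) *ᵥ v = a ^ k • v := by
    intro k
    induction k with
    | zero => simp
    | succ k ih => rw [pow_succ, ← Matrix.mulVec_mulVec, h, Matrix.mulVec_smul, ih, smul_smul,
        pow_succ, mul_comm]
  have h1 : HasSum (fun k : ℕ => ((k.factorial : ℝ)⁻¹) • A ^ k) (NormedSpace.exp A) :=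
    open scoped Matrix.Norms.Operator in NormedSpace.exp_series_hasSum_exp' (𝕂 := ℝ) A
  have h2 : HasSum (fun k : ℕ => ((k.factorial : ℝ)⁻¹) • a ^ k) (Real.exp a) := by
    rw [Real.exp_eq_exp_ℝ]
    exact NormedSpace.exp_series_hasSum_exp' (𝕂 := ℝ) a
  have h3 := h1.map (⟨⟨fun B : Mat p q => B *ᵥ v, Matrix.zero_mulVec v⟩,
    fun B C => Matrix.add_mulVec B C v⟩ : Mat p q →+ StdRep p q)
    (Continuous.matrix_mulVec continuous_id continuous_const)
  have h4 := h2.smul_const v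
  refine h3.unique ?_
  convert h4 using 1
  funext k
  simp [Matrix.smul_mulVec, hpow, smul_smul]

/-- The exponential map `𝔭 → P`, given by the matrix exponential. -/
def pExp {p q : ℕ} (A : LieAlg p q) (hA : IsParabolicElt A) : Parabolic p q :=
  ⟨⟨NormedSpace.exp (A : Mat p q), det_exp_eq_one ((mem_lieAlg _).1 A.2)⟩,
    exp_orth ((mem_lieAlg _).1 A.2), by
      obtain ⟨a, ha⟩ := hA
      exact ⟨Real.exp a, Real.exp_pos a, exp_mulVec_eigen ha⟩⟩

/-! ### Conformal structures -/

section Conformal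

variable (p q : ℕ) (M : Type*) [TopologicalSpace M]
  [ChartedSpace (EuclideanSpace ℝ (Fin (p + q))) M] [IsManifold (𝓡 (p + q)) ∞ M]

/-- A smooth pseudo-Riemannian metric of signature `(p,q)` on `M`. -/
structure PseudoRiemannianMetric where
  /-- The inner product on each tangent space. -/
  inner (x : M) : TangentSpace (𝓡 (p + q)) x →L[ℝ] TangentSpace (𝓡 (p + q)) x →L[ℝ] ℝ
  symm : ∀ (x : M) (v w : TangentSpace (𝓡 (p + q)) x), inner x v w = inner x w v
  signature : ∀ x : M, ∃ b : Module.Basis (Fin (p + q)) ℝ (TangentSpace (𝓡 (p + q)) x),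
    ∀ i j, inner x (b i) (b j) = if i = j then eps i else 0
  smooth : ContMDiff (𝓡 (p + q))
    ((𝓡 (p + q)).prod 𝓘(ℝ, EuclideanSpace ℝ (Fin (p + q)) →L[ℝ]
      EuclideanSpace ℝ (Fin (p + q)) →L[ℝ] ℝ)) ∞
    (fun x => Bundle.TotalSpace.mk' (EuclideanSpace ℝ (Fin (p + q)) →L[ℝ]
      EuclideanSpace ℝ (Fin (p + q)) →L[ℝ] ℝ)
      (E := fun x : M => TangentSpace (𝓡 (p + q)) x →L[ℝ] TangentSpace (𝓡 (p + q)) x →L[ℝ] ℝ)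
      x (inner x))

variable {p q M}

/-- The conformal class `[g]`: all metrics of the form `f g` with `f` smooth and positive. -/
def conformalClass (g : PseudoRiemannianMetric p q M) : Set (PseudoRiemannianMetric p q M) :=
  {g' | ∃ f : M → ℝ, ContMDiff (𝓡 (p + q)) 𝓘(ℝ, ℝ) ∞ f ∧ (∀ x, 0 < f x) ∧
    ∀ x, g'.inner x = f x • g.inner x}

variable (p q M)

/-- A conformal pseudo-Riemannian structure of signature `(p,q)` on `M`: a conformal class. -/
structure ConformalStructure where
  /-- The metrics belonging to the conformal class. -/
  metrics : Set (PseudoRiemannianMetric p q M)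
  isClass : ∃ g, metrics = conformalClass g

end Conformal

/-! ### Cartan geometries of type `(SO(p+1,q+1), P)` -/

section Cartan

variable (p q : ℕ) (M : Type*) [TopologicalSpace M]
  [ChartedSpace (EuclideanSpace ℝ (Fin (p + q))) M]
  {E : Type*} [NormedAddCommGroup E] [NormedSpace ℝ E]
  (B : Type*) [TopologicalSpace B] [ChartedSpace E B]
  [MulAction (Parabolic p q)ᵐᵒᵖ B]

/-- A smooth principal `P`-bundle `proj : B → M`, the principal right action being written
`u <• b`. The group `P` carries its structure of an embedded submanifold of the space of matrices:
maps into `P` are smooth when they are smooth as matrix-valued maps, and maps on `B × P` are smooth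
when they are restrictions of maps on `B × Mat` which are smooth on the subset `B × P`. -/
structure PrincipalBundle where
  /-- The bundle projection. -/
  proj : B → M
  proj_smooth : ContMDiff 𝓘(ℝ, E) (𝓡 (p + q)) ∞ proj
  proj_act : ∀ (u : B) (b : Parabolic p q), proj (u <• b) = proj u
  act_free : ∀ (u : B) (b : Parabolic p q), u <• b = u → b = 1
  act_transitive : ∀ u u' : B, proj u' = proj u → ∃ b : Parabolic p q, u' = u <• b
  act_smooth : ∃ F : B × (Idx p q → Idx p q → ℝ) → B,
    ContMDiffOn (𝓘(ℝ, E).prod 𝓘(ℝ, Idx p q → Idx p q → ℝ)) 𝓘(ℝ, E) ∞ F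
      {z | ∃ b : Parabolic p q, z.2 = entries (pMat b)} ∧
    ∀ (u : B) (b : Parabolic p q), F (u, entries (pMat b)) = u <• b
  locally_trivial : ∀ x : M, ∃ (U : Set M) (s : M → B) (t : B → Parabolic p q),
    IsOpen U ∧ x ∈ U ∧
    ContMDiffOn (𝓡 (p + q)) 𝓘(ℝ, E) ∞ s U ∧
    ContMDiffOn 𝓘(ℝ, E) 𝓘(ℝ, Idx p q → Idx p q → ℝ) ∞
      (fun u => entries (pMat (t u))) (proj ⁻¹' U) ∧
    (∀ y ∈ U, proj (s y) = y) ∧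
    ∀ u, proj u ∈ U → u = s (proj u) <• t u

/-- A Cartan geometry of type `(G,P)` on `M`, with `G = SO(p+1,q+1)` and `P` the stabiliser of an
isotropic ray: a principal `P`-bundle with a Cartan connection `ω ∈ Ω¹(B, 𝔤)`. -/
structure CartanGeometry [IsManifold 𝓘(ℝ, E) ∞ B] extends
    PrincipalBundle p q M (E := E) B where
  /-- The Cartan connection, a linear isomorphism `T_u B → 𝔤` at each point `u`. -/
  form (u : B) : TangentSpace 𝓘(ℝ, E) u ≃ₗ[ℝ] LieAlg p q
  form_smooth : ContMDiff 𝓘(ℝ, E).tangent 𝓘(ℝ, Idx p q → Idx p q → ℝ) ∞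
    (fun v : TangentBundle 𝓘(ℝ, E) B => entries (form v.1 v.2 : Mat p q))
  form_equivariant : ∀ (u : B) (b : Parabolic p q) (ξ : TangentSpace 𝓘(ℝ, E) u),
    (form (u <• b) (mfderiv 𝓘(ℝ, E) 𝓘(ℝ, E) (fun v : B => v <• b) u ξ) : Mat p q) =
      pMat b⁻¹ * (form u ξ : Mat p q) * pMat b
  /-- `ω` reproduces the generators of the fundamental vector fields. -/
  form_fundamental : ∀ (A : LieAlg p q) (hA : IsParabolicElt A) (u : B),
    form (u <• pExp ((0 : ℝ) • A) (hA.smul 0))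
      (mfderiv 𝓘(ℝ, ℝ) 𝓘(ℝ, E) (fun t : ℝ => u <• pExp (t • A) (hA.smul t)) 0 (1 : ℝ)) = A

end Cartan

theorem PrincipalBundle.act_inj {p q : ℕ} {M : Type*} [TopologicalSpace M]
  [ChartedSpace (EuclideanSpace ℝ (Fin (p + q))) M]
  {E : Type*} [NormedAddCommGroup E] [NormedSpace ℝ E]
  {B : Type*} [TopologicalSpace B] [ChartedSpace E B]
  [MulAction (Parabolic p q)ᵐᵒᵖ B] (C : PrincipalBundle p q M (E := E) B)
  {u : B} {b c : Parabolic p q} (h : u <• b = u <• c) : b = c := by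
  have h1 : u <• (b * c⁻¹) = u := by
    rw [op_smul_mul, h, ← op_smul_mul, mul_inv_cancel, MulOpposite.op_one, one_smul]
  exact mul_inv_eq_one.mp (C.act_free u _ h1)

namespace CartanGeometry

variable {p q : ℕ} {M : Type*} [TopologicalSpace M]
  [ChartedSpace (EuclideanSpace ℝ (Fin (p + q))) M]
  {E : Type*} [NormedAddCommGroup E] [NormedSpace ℝ E]
  {B : Type*} [TopologicalSpace B] [ChartedSpace E B]
  [IsManifold 𝓘(ℝ, E) ∞ B] [MulAction (Parabolic p q)ᵐᵒᵖ B]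
  (C : CartanGeometry p q M (E := E) B)

/-- The constant vector field `X̃` on `B` determined by `X ∈ 𝔤`: `ω(X̃) = X`. -/
def constField (X : LieAlg p q) (u : B) : TangentSpace 𝓘(ℝ, E) u := (C.form u).symm X

/-- The curvature function `κ(u)(X,Y) = dω(X̃,Ỹ)(u) + [X,Y] = [X,Y] - ω([X̃,Ỹ])(u)`. -/
def curvature (u : B) (X Y : LieAlg p q) : Mat p q :=
  ((X : Mat p q) * (Y : Mat p q) - (Y : Mat p q) * (X : Mat p q)) -
    (C.form u (VectorField.mlieBracket 𝓘(ℝ, E) (C.constField X) (C.constField Y) u) : Mat p q)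

/-- Normality, `∂^*κ = 0`: for all `Y`, `∑ᵢ [Zⁱ, κ(Xᵢ, Y)] = 0`, where `Xᵢ` is a basis of `𝔤_{-1}`
and `Zⁱ` is the dual basis of `𝔤_1` with respect to an invariant form (for the standard bases below
one has `tr (Xᵢ Zʲ) = 2 δᵢʲ`). -/
def IsNormal : Prop :=
  ∀ (u : B) (Y : LieAlg p q),
    ∑ i : Fin (p + q),
      ((gPos (Pi.single i 1) : Mat p q) * C.curvature u (gNeg (Pi.single i 1)) Y -
        C.curvature u (gNeg (Pi.single i 1)) Y * (gPos (Pi.single i 1) : Mat p q)) = 0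

/-- The Cartan geometry induces the conformal structure `c`: for each `u ∈ B` the isomorphism
`T_{proj u} M ≅ 𝔤/𝔭 ≅ ℝ^{p,q}` determined by `ω_u` identifies the metrics in `c` with positive
multiples of the standard inner product of signature `(p,q)`. -/
def Induces [IsManifold (𝓡 (p + q)) ∞ M] (c : ConformalStructure p q M) : Prop :=
  ∀ g ∈ c.metrics, ∀ u : B, ∃ r : ℝ, 0 < r ∧ ∀ ξ η : TangentSpace 𝓘(ℝ, E) u,
    g.inner (C.proj u) (mfderiv 𝓘(ℝ, E) (𝓡 (p + q)) C.proj u ξ)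
        (mfderiv 𝓘(ℝ, E) (𝓡 (p + q)) C.proj u η) =
      r * innerPQ (negPart (C.form u ξ)) (negPart (C.form u η))

/-- The normal Cartan geometry of the conformal structure `c`. -/
structure IsNormalConformal [IsManifold (𝓡 (p + q)) ∞ M] (c : ConformalStructure p q M) :
    Prop where
  induces : C.Induces c
  normal : C.IsNormal

/-! ### The standard tractor bundle `B ×_P ℝ^{p+1,q+1}` and its tractor connection -/

/-- The fibre over `x` of the standard tractor bundle `B ×_P ℝ^{p+1,q+1}`, an element being given by
the corresponding `P`-equivariant function on the fibre of `B` over `x`; the class of `(u, v)` is the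
function with value `b⁻¹ v` at `u <• b`. -/
def TractorFiber (x : M) : Submodule ℝ ({u : B // C.proj u = x} → StdRep p q) where
  carrier := {f | ∀ (u u' : {u : B // C.proj u = x}) (b : Parabolic p q),
    u'.1 = u.1 <• b → f u' = pMat b⁻¹ *ᵥ f u}
  add_mem' := by
    intro f g hf hg u u' b h
    rw [Pi.add_apply, Pi.add_apply, hf u u' b h, hg u u' b h, Matrix.mulVec_add]
  zero_mem' := by
    intro u u' b _
    simp
  smul_mem' := by
    intro c f hf u u' b h
    rw [Pi.smul_apply, Pi.smul_apply, hf u u' b h, Matrix.mulVec_smul]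

/-- The class `[u, v]` in the fibre over `x = proj u` of `B ×_P ℝ^{p+1,q+1}`. -/
def tractorClass {x : M} (u : {u : B // C.proj u = x}) (v : StdRep p q) : C.TractorFiber x :=
  ⟨fun u' => pMat (C.act_transitive u.1 u'.1 (u'.2.trans u.2.symm)).choose⁻¹ *ᵥ v, by
    intro u₁ u₂ b h
    have h1 := (C.act_transitive u.1 u₁.1 (u₁.2.trans u.2.symm)).choose_spec
    have h2 := (C.act_transitive u.1 u₂.1 (u₂.2.trans u.2.symm)).choose_spec
    set b₁ := (C.act_transitive u.1 u₁.1 (u₁.2.trans u.2.symm)).choose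
    set b₂ := (C.act_transitive u.1 u₂.1 (u₂.2.trans u.2.symm)).choose
    have h3 : b₂ = b₁ * b := by
      apply C.act_inj (u := u.1)
      rw [← h2, op_smul_mul, ← h1, h]
    have h4 : pMat b₂⁻¹ = pMat b⁻¹ * pMat b₁⁻¹ := by
      rw [h3, mul_inv_rev]
      exact Matrix.SpecialLinearGroup.coe_mul _ _
    change pMat b₂⁻¹ *ᵥ v = pMat b⁻¹ *ᵥ (pMat b₁⁻¹ *ᵥ v)
    rw [Matrix.mulVec_mulVec, h4]⟩

theorem tractorClass_apply {x : M} (u u' : {u : B // C.proj u = x}) (v : StdRep p q)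
    (b : Parabolic p q) (h : u'.1 = u.1 <• b) :
    (C.tractorClass u v).1 u' = pMat b⁻¹ *ᵥ v := by
  have h2 := (C.act_transitive u.1 u'.1 (u'.2.trans u.2.symm)).choose_spec
  have h3 := C.act_inj (h.symm.trans h2)
  change pMat (C.act_transitive u.1 u'.1 (u'.2.trans u.2.symm)).choose⁻¹ *ᵥ v = _
  rw [← h3]

/-- Sections (not necessarily smooth) of the standard tractor bundle over `U ⊆ M`. -/
abbrev TractorSection (U : Set M) : Type _ := ∀ x : U, C.TractorFiber (x : M)

variable {C} {U : Set M}

open Classical in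
/-- The `P`-equivariant function `proj ⁻¹ U → ℝ^{p+1,q+1}` corresponding to a section over `U`
(set to zero outside of `proj ⁻¹ U`). -/
def TractorSection.toFun (s : C.TractorSection U) (u : B) : StdRep p q :=
  if h : C.proj u ∈ U then (s ⟨C.proj u, h⟩).1 ⟨u, rfl⟩ else 0

/-- Smoothness of a section over `U`. -/
def TractorSection.IsSmooth (s : C.TractorSection U) : Prop :=
  ContMDiffOn 𝓘(ℝ, E) 𝓘(ℝ, StdRep p q) ∞ s.toFun (C.proj ⁻¹' U)

/-- The tractor connection: if `f` is the equivariant function of `s` and `ξ ∈ T_u B` is any lift of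
a tangent vector `η` of `M` at `x = proj u`, then `(∇_η s)(x)` is the class of `u` and
`df(ξ) + ω(ξ) f(u)`. -/
def TractorSection.nabla (s : C.TractorSection U) (u : B) (ξ : TangentSpace 𝓘(ℝ, E) u) :
    StdRep p q :=
  let df : StdRep p q := mfderiv 𝓘(ℝ, E) 𝓘(ℝ, StdRep p q) s.toFun u ξ
  df + (C.form u ξ : Mat p q) *ᵥ s.toFun u

/-- Parallel (smooth) sections over an open set `U`. -/
structure TractorSection.IsParallel (s : C.TractorSection U) : Prop where
  smooth : s.IsSmooth
  nabla_eq_zero : ∀ u : B, C.proj u ∈ U → ∀ ξ : TangentSpace 𝓘(ℝ, E) u, s.nabla u ξ = 0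

/-! ### Normal charts and normal frames -/

variable (C)

/-- `u₁ = Fl^{X̃}_1(u₀)`: the flow line of the constant field `X̃` through `u₀` is defined up to
time `1` and reaches `u₁` at time `1`. -/
def FlowsTo (X : LieAlg p q) (u₀ u₁ : B) : Prop :=
  ∃ (a b : ℝ) (γ : ℝ → B), a < 0 ∧ 1 < b ∧
    IsMIntegralCurveOn (I := 𝓘(ℝ, E)) γ (C.constField X) (Set.Ioo a b) ∧ γ 0 = u₀ ∧ γ 1 = u₁

/-- A normal chart determined by `u₀ ∈ B`. Here `𝔤_- = 𝔤_{-1}` is identified with `ℝⁿ`. With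
`Φ(X) = Fl^{X̃}_1(u₀)`, the map `proj ∘ Φ` is a diffeomorphism from a star-shaped open neighbourhood
`V` of zero (the target of `chart`) onto an open subset `U` of `M` (the source of `chart`), and
`chart` is its inverse. -/
structure NormalChart (u₀ : B) where
  /-- The diffeomorphism from `U ⊆ M` to `V ⊆ ℝⁿ`. -/
  chart : OpenPartialHomeomorph M (EuclideanSpace ℝ (Fin (p + q)))
  smooth : chart ∈ IsManifold.maximalAtlas (𝓡 (p + q)) ∞ M
  zero_mem : 0 ∈ chart.target
  starConvex : StarConvex ℝ 0 chart.target
  /-- The map `Φ`; only its values on `V` are relevant. -/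
  Φ : EuclideanSpace ℝ (Fin (p + q)) → B
  flow : ∀ X ∈ chart.target, C.FlowsTo (gNeg X.ofLp) u₀ (Φ X)
  proj_Φ : ∀ X ∈ chart.target, C.proj (Φ X) = chart.symm X

namespace NormalChart

variable {C} {u₀ : B} (N : C.NormalChart u₀)

/-- The domain `U` of the normal chart. -/
def domain : Set M := N.chart.source

/-- The normal coordinates `x_1, …, x_n` on `U`. -/
def coord (i : Fin (p + q)) (x : N.domain) : ℝ := N.chart (x : M) i

/-- The normal section `σ : U → B`, characterised by `σ(proj (Φ X)) = Φ X`. -/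
def normalSection (x : N.domain) : {u : B // C.proj u = (x : M)} :=
  ⟨N.Φ (N.chart (x : M)), by
    rw [N.proj_Φ _ (N.chart.map_source x.2), N.chart.left_inv x.2]⟩

/-- The normal frame of the standard tractor bundle corresponding to the standard basis of
`ℝ^{p+1,q+1}`: `s_a(x) = [σ(x), e_a]`. -/
def frame (a : Idx p q) : C.TractorSection N.domain :=
  fun x => C.tractorClass (N.normalSection x) (stdBasis a)

/-- `s̃_0 = s_0 - ∑ x_i s_i - ½ (∑ ε_i x_i²) s_{n+1}`. -/
def tildeFirst : C.TractorSection N.domain := fun x =>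
  N.frame (iFirst p q) x - ∑ i, N.coord i x • N.frame (iMid i) x -
    ((1 / 2 : ℝ) * ∑ i, eps i * N.coord i x ^ 2) • N.frame (iLast p q) x

/-- `s̃_i = s_i + ε_i x_i s_{n+1}`. -/
def tildeMid (i : Fin (p + q)) : C.TractorSection N.domain := fun x =>
  N.frame (iMid i) x + (eps i * N.coord i x) • N.frame (iLast p q) x

/-- `s̃_{n+1} = s_{n+1}`. -/
def tildeLast : C.TractorSection N.domain := N.frame (iLast p q)

end NormalChart

end CartanGeometry

end ConformalTractor

end

open ConformalTractor

/-! Let `f` be the equivariant function of a parallel section. Since `ω(X̃) = X`, vanishing of the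
tractor derivative in the direction `X̃` reads `X̃ f = -X f`. Along the flow line of `X̃` from `u₀`
this is a linear equation with constant coefficients, so `f(Φ(X)) = exp(-X) f(u₀)`. On `𝔤_{-1}` one
has `X³ = 0`, hence `exp(-X) = 1 - X + X²/2`, and the images of the `e_a` under it are exactly the
coordinates of the sections `s̃_a` in the normal frame. The constant coefficients are therefore the
components of `f(u₀)`.

The analytic point is that `Φ(tX)`, for `0 ≤ t ≤ 1`, must trace a single integral curve of `X̃`,
although each `Φ(tX)` comes with its own curve. `FlowsTo.exists_curve` obtains this from uniqueness
of integral curves, which requires `X̃` to be `C¹`; that is `contMDiff_symm_const_of_coframe`. The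
equation itself is solved in `eq_exp_neg_negMat`. -/

/-! ### Regularity of the fields dual to a coframe -/

open Bundle in
open scoped Topology in
/-- If a fibrewise linear isomorphism `θ y : T_y B ≃ W` onto a
subspace `W` of `F` is `C¹`, then so is the vector field which `θ` maps to a constant. -/
theorem contMDiff_symm_const_of_coframe {E F : Type*} [NormedAddCommGroup E] [NormedSpace ℝ E]
    [FiniteDimensional ℝ E] [NormedAddCommGroup F] [NormedSpace ℝ F] [FiniteDimensional ℝ F]
    {B : Type*} [TopologicalSpace B] [ChartedSpace E B] [IsManifold 𝓘(ℝ, E) 2 B]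
    {W : Type*} [AddCommGroup W] [Module ℝ W] (j : W →ₗ[ℝ] F) (hj : Function.Injective j)
    (θ : ∀ y : B, TangentSpace 𝓘(ℝ, E) y ≃ₗ[ℝ] W)
    (hθ : ContMDiff 𝓘(ℝ, E).tangent 𝓘(ℝ, F) 1 (fun v : TangentBundle 𝓘(ℝ, E) B => j (θ v.1 v.2)))
    (X : W) :
    ContMDiff 𝓘(ℝ, E) 𝓘(ℝ, E).tangent 1
      (fun y => (⟨y, (θ y).symm X⟩ : TangentBundle 𝓘(ℝ, E) B)) := by
  have : ContMDiffVectorBundle 1 E (TangentSpace 𝓘(ℝ, E) : B → Type _) 𝓘(ℝ, E) :=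
    have : IsManifold 𝓘(ℝ, E) (1 + 1) B := by norm_num; infer_instance
    TangentBundle.contMDiffVectorBundle
  intro y₀
  rw [contMDiffAt_section]
  set e := trivializationAt E (TangentSpace 𝓘(ℝ, E) : B → Type _) y₀
  have hy₀ : y₀ ∈ e.baseSet := mem_baseSet_trivializationAt E _ y₀
  let b := Module.finBasis ℝ E
  -- `R` is a left inverse of `j ∘ θ` at `y₀` only. In a trivialisation, `A y` is the endomorphism
  -- `R ∘ j ∘ θ y` of `E`; it is the identity at `y₀` up to the trivialisation, hence invertible
  -- nearby.
  obtain ⟨R₀, hR₀⟩ := LinearMap.exists_leftInverse_of_injective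
    (j ∘ₗ (θ y₀ : TangentSpace 𝓘(ℝ, E) y₀ →ₗ[ℝ] W))
    (LinearMap.ker_eq_bot.2 (hj.comp (θ y₀).injective))
  let R : F →L[ℝ] E := LinearMap.toContinuousLinearMap (R₀ : F →ₗ[ℝ] E)
  have hR : ∀ w : TangentSpace 𝓘(ℝ, E) y₀, R (j (θ y₀ w)) = w := fun w => LinearMap.congr_fun hR₀ w
  let A : B → E →L[ℝ] E := fun y => ∑ i, (LinearMap.toContinuousLinearMap (b.coord i)).smulRight
    (R (j (θ y (e.localFrame b i y))))
  have hA : ContMDiffAt 𝓘(ℝ, E) 𝓘(ℝ, E →L[ℝ] E) 1 A y₀ := by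
    have key : ∀ i, ContMDiffAt 𝓘(ℝ, E) 𝓘(ℝ, E) 1
        (fun y => R (j (θ y (e.localFrame b i y)))) y₀ := fun i =>
      R.contMDiff.contMDiffAt.comp y₀ (hθ.contMDiffAt.comp y₀
        (contMDiffAt_localFrame_of_mem (I := 𝓘(ℝ, E)) (n := 1) (e := e) b i hy₀))
    refine ContMDiffAt.sum fun i _ => ?_
    exact ((ContinuousLinearMap.smulRightL ℝ E E
      (LinearMap.toContinuousLinearMap (b.coord i))).contMDiff.contMDiffAt).comp y₀ (key i)
  have hAe : ∀ y ∈ e.baseSet, ∀ w : TangentSpace 𝓘(ℝ, E) y, A y (e ⟨y, w⟩).2 = R (j (θ y w)) := by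
    intro y hy w
    have h1 : ∑ i, b.coord i (e.linearEquivAt ℝ y hy w) • e.localFrame b i y = w := by
      conv_rhs => rw [← (e.basisAt b hy).sum_repr w]
      refine Finset.sum_congr rfl fun i _ => ?_
      rw [e.localFrame_apply_of_mem_baseSet b hy]
      rfl
    conv_rhs => rw [← h1]
    rw [map_sum, map_sum, map_sum, sum_apply]
    refine Finset.sum_congr rfl fun i _ => ?_
    rw [map_smul, map_smul, map_smul]
    rfl
  have hinj : Function.Injective (A y₀) := by
    rw [injective_iff_map_eq_zero]
    intro v hv
    obtain ⟨w, rfl⟩ := (e.linearEquivAt ℝ y₀ hy₀).surjective v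
    have h1 : w = 0 := ((hAe y₀ hy₀ w).trans (hR w)).symm.trans hv
    rw [h1, map_zero]
  let A₀ : E ≃L[ℝ] E := (LinearEquiv.ofInjectiveEndo (A y₀ : E →ₗ[ℝ] E) hinj).toContinuousLinearEquiv
  have hA₀ : (A₀ : E →L[ℝ] E) = A y₀ := by ext v; rfl
  -- The field is `A(y)⁻¹ R(j X)` in the trivialisation, and inversion is smooth at an invertible
  -- operator. `inverse` is meaningful only where `A y` is invertible, so the identification holds
  -- on a neighbourhood of `y₀`.
  have hinv : ContMDiffAt 𝓘(ℝ, E) 𝓘(ℝ, E) 1 (fun y => (A y).inverse (R (j X))) y₀ := by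
    have h1 : ContDiffAt ℝ 1 ContinuousLinearMap.inverse (A y₀) := by
      rw [← hA₀]; exact contDiffAt_map_inverse A₀
    exact (h1.contMDiffAt.comp y₀ hA).clm_apply contMDiffAt_const
  have hunit : ∀ᶠ y in 𝓝 y₀, A y ∈ Set.range ((↑) : (E ≃L[ℝ] E) → E →L[ℝ] E) :=
    hA.continuousAt.eventually_mem (by rw [← hA₀]; exact ContinuousLinearEquiv.nhds A₀)
  refine hinv.congr_of_eventuallyEq ?_
  filter_upwards [hunit, e.open_baseSet.mem_nhds hy₀] with y hy hye
  obtain ⟨G, hG⟩ := hy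
  have h1 := hAe y hye ((θ y).symm X)
  rw [LinearEquiv.apply_symm_apply] at h1
  rw [← h1, ← hG, ContinuousLinearMap.inverse_equiv]
  exact (G.symm_apply_apply _).symm

/-! ### Constant fields, their flow lines, and parallel sections along them -/

namespace ConformalTractor

/-- The inclusion of `𝔤` into the arrays of reals. -/
def lieAlgEntries (p q : ℕ) : LieAlg p q →ₗ[ℝ] (Idx p q → Idx p q → ℝ) where
  toFun A := entries (A : Mat p q)
  map_add' _ _ := rfl
  map_smul' _ _ := rfl

theorem gNeg_smul {p q : ℕ} (t : ℝ) (x : Fin (p + q) → ℝ) : gNeg (t • x) = t • gNeg x := by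
  apply Subtype.ext
  ext a b
  rcases a with a | a | a <;> rcases b with b | b | b <;>
    simp [gNeg, negMat, mul_left_comm]

namespace CartanGeometry

variable {p q : ℕ} {M : Type*} [TopologicalSpace M]
  [ChartedSpace (EuclideanSpace ℝ (Fin (p + q))) M]
  {E : Type*} [NormedAddCommGroup E] [NormedSpace ℝ E]
  {B : Type*} [TopologicalSpace B] [ChartedSpace E B]
  [IsManifold 𝓘(ℝ, E) ∞ B] [MulAction (Parabolic p q)ᵐᵒᵖ B]
  (C : CartanGeometry p q M (E := E) B)

/-- The model space `E` is identified with `𝔤` by `ω` at any one point. -/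
theorem finiteDimensional (C : CartanGeometry p q M (E := E) B) (u : B) : FiniteDimensional ℝ E :=
  Module.Finite.equiv (M := LieAlg p q) (N := E) (C.form u).symm

theorem constField_smul (t : ℝ) (X : LieAlg p q) :
    C.constField (t • X) = t • C.constField X := by
  funext u
  exact (C.form u).symm.map_smul t X

theorem contMDiff_constField [FiniteDimensional ℝ E] (X : LieAlg p q) :
    ContMDiff 𝓘(ℝ, E) 𝓘(ℝ, E).tangent 1
      (fun u => (⟨u, C.constField X u⟩ : TangentBundle 𝓘(ℝ, E) B)) :=
  have : IsManifold 𝓘(ℝ, E) 2 B := IsManifold.of_le (n := ∞) ENat.LEInfty.out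
  contMDiff_symm_const_of_coframe (lieAlgEntries p q) (fun _ _ h => Subtype.ext h) C.form
    (C.form_smooth.of_le (by exact_mod_cast le_top)) X

/-- Flow lines of `X̃` are unique, and the time-`1` point of the flow line of `t X̃` is the
time-`t` point of the flow line of `X̃`. -/
theorem FlowsTo.exists_curve [T2Space B] {u₀ : B} {X : LieAlg p q} {u : ℝ → B}
    (h : ∀ t ∈ Set.Icc (0 : ℝ) 1, C.FlowsTo (t • X) u₀ (u t)) :
    ∃ γ : ℝ → B, γ 0 = u₀ ∧ ∀ t ∈ Set.Icc (0 : ℝ) 1, γ t = u t ∧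
      HasMFDerivAt 𝓘(ℝ, ℝ) 𝓘(ℝ, E) γ t ((1 : ℝ →L[ℝ] ℝ).smulRight (C.constField X (γ t))) := by
  have := C.finiteDimensional u₀
  have : CompleteSpace E := FiniteDimensional.complete ℝ E
  -- The flow line for `t = 1` serves as the common curve; the others are compared with it.
  obtain ⟨a, b, γ, ha, hb, hγ, hγ0, -⟩ := h 1 (by simp)
  rw [one_smul] at hγ
  refine ⟨γ, hγ0, fun t ht => ⟨?_, ?_⟩⟩
  · obtain ⟨a', b', γ', ha', hb', hγ', hγ'0, hγ'1⟩ := h t ht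
    -- The curve `r ↦ γ(r t)` is integral for `t X̃`. As `0 ≤ t ≤ 1`, it is defined wherever `r`
    -- lies in `(a, b)`, so both curves live on an interval containing `0` and `1`.
    have hc := hγ.comp_mul t
    rw [← C.constField_smul] at hc
    have key := isMIntegralCurveOn_Ioo_eqOn_of_contMDiff_boundaryless
      (a := max a a') (b := min b b') (t₀ := 0) (by simp; grind)
      (C.contMDiff_constField (t • X))
      (hc.mono fun r hr => by
        obtain ⟨h1, h2⟩ := hr
        rw [max_lt_iff] at h1
        rw [lt_min_iff] at h2
        constructor
        · rcases le_total 0 r with h | h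
          · exact ha.trans_le (mul_nonneg h ht.1)
          · exact h1.1.trans_le (by nlinarith [ht.2])
        · rcases le_total 0 r with h | h
          · exact (mul_le_of_le_one_right h ht.2).trans_lt h2.1
          · exact (mul_nonpos_of_nonpos_of_nonneg h ht.1).trans_lt (one_pos.trans hb))
      (hγ'.mono (Set.Ioo_subset_Ioo (le_max_right _ _) (min_le_right _ _)))
      (by simp [hγ0, hγ'0])
    have h1 := key (x := 1) (by simp; grind)
    simpa [hγ'1] using h1
  · have hmem : t ∈ Set.Ioo a b := ⟨ha.trans_le ht.1, ht.2.trans_lt hb⟩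
    exact (hγ t hmem).hasMFDerivAt (isOpen_Ioo.mem_nhds hmem)

variable {C} in
/-- The equivariant function of a parallel section satisfies `f' = -X f` along flow lines
of `X̃`. -/
theorem TractorSection.IsParallel.hasDerivAt {U : Set M} (hU : IsOpen U) {s : C.TractorSection U}
    (hs : s.IsParallel) {γ : ℝ → B} {t : ℝ} (ht : C.proj (γ t) ∈ U) {X : LieAlg p q}
    (hγ : HasMFDerivAt 𝓘(ℝ, ℝ) 𝓘(ℝ, E) γ t
      ((1 : ℝ →L[ℝ] ℝ).smulRight (C.constField X (γ t)))) :
    HasDerivAt (fun r => s.toFun (γ r)) (-((X : Mat p q) *ᵥ s.toFun (γ t))) t := by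
  have hopen : IsOpen (C.proj ⁻¹' U) := hU.preimage C.proj_smooth.continuous
  have hf := ((hs.smooth.contMDiffAt (hopen.mem_nhds ht)).mdifferentiableAt
    (by simp)).hasMFDerivAt
  let D : E →L[ℝ] StdRep p q := mfderiv 𝓘(ℝ, E) 𝓘(ℝ, StdRep p q) s.toFun (γ t)
  let v : E := C.constField X (γ t)
  have h1 : HasFDerivAt (s.toFun ∘ γ) (D.comp ((1 : ℝ →L[ℝ] ℝ).smulRight v)) t :=
    (hf.comp t hγ).hasFDerivAt
  have h2 := hs.nabla_eq_zero (γ t) ht (C.constField X (γ t))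
  simp only [TractorSection.nabla, constField, LinearEquiv.apply_symm_apply] at h2
  refine h1.hasDerivAt.congr_deriv ?_
  rw [← eq_neg_of_add_eq_zero_left h2]
  exact congrArg D (one_smul ℝ v)

end CartanGeometry

/-! ### The linear equation for `X ∈ 𝔤_{-1}` -/

/-- The solution of `h' = -X h` for `X ∈ 𝔤_{-1}` is `h(1) = exp(-X) h(0)`. -/
theorem eq_exp_neg_negMat {p q : ℕ} (x : Fin (p + q) → ℝ) (h : ℝ → StdRep p q)
    (hd : ∀ t ∈ Set.Icc (0 : ℝ) 1, HasDerivAt h (-(negMat x *ᵥ h t)) t) :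
    h 1 = h 0 (iFirst p q) • (stdBasis (iFirst p q) - ∑ i, x i • stdBasis (iMid i)
        - ((1 / 2 : ℝ) * ∑ i, eps i * x i ^ 2) • stdBasis (iLast p q))
      + ∑ i, h 0 (iMid i) • (stdBasis (iMid i) + (eps i * x i) • stdBasis (iLast p q))
      + h 0 (iLast p q) • stdBasis (iLast p q) := by
  -- No matrix exponential is needed: the components of `exp(tX) h(t)` are polynomial in `t` and are
  -- checked directly to be conserved.
  have hconst : ∀ f : ℝ → ℝ, (∀ t ∈ Set.Icc (0 : ℝ) 1, HasDerivAt f 0 t) → f 1 = f 0 := by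
    intro f hf
    exact constant_of_has_deriv_right_zero (fun t ht => (hf t ht).continuousAt.continuousWithinAt)
      (fun t ht => (hf t ⟨ht.1, ht.2.le⟩).hasDerivWithinAt) 1 (by simp)
  have hcomp := fun t ht a => hasDerivAt_pi.1 (hd t ht) a
  have d0 : ∀ t ∈ Set.Icc (0 : ℝ) 1, HasDerivAt (fun r => h r (iFirst p q)) 0 t := by
    intro t ht
    simpa [Matrix.mulVec, dotProduct, negMat] using hcomp t ht (iFirst p q)
  have di : ∀ i, ∀ t ∈ Set.Icc (0 : ℝ) 1,
      HasDerivAt (fun r => h r (iMid i)) (-(x i * h t (iFirst p q))) t := by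
    intro i t ht
    simpa [Matrix.mulVec, dotProduct, negMat] using hcomp t ht (iMid i)
  have dl : ∀ t ∈ Set.Icc (0 : ℝ) 1, HasDerivAt (fun r => h r (iLast p q))
      (∑ i, eps i * x i * h t (iMid i)) t := by
    intro t ht
    simpa [Matrix.mulVec, dotProduct, negMat] using hcomp t ht (iLast p q)
  have e0 : h 1 (iFirst p q) = h 0 (iFirst p q) := hconst _ d0
  have ei : ∀ i, h 1 (iMid i) = h 0 (iMid i) - x i * h 0 (iFirst p q) := by
    intro i
    have := hconst (fun r => h r (iMid i) + r * (x i * h r (iFirst p q))) (fun t ht => by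
      refine ((di i t ht).add ((hasDerivAt_id' t).mul ((d0 t ht).const_mul (x i)))).congr_deriv ?_
      ring)
    simp only [e0] at this
    linarith
  have el : h 1 (iLast p q) = h 0 (iLast p q) + ∑ i, eps i * x i * h 0 (iMid i) -
      (1 / 2) * (∑ i, eps i * x i ^ 2) * h 0 (iFirst p q) := by
    -- Last component of `exp(rX) h(r)`; the `r²` term, from `X²/2`, cancels the drift of the middle
    -- components.
    have := hconst (fun r => h r (iLast p q) - r * ∑ i, eps i * x i * h r (iMid i) -
        r ^ 2 * ((1 / 2) * (∑ i, eps i * x i ^ 2) * h r (iFirst p q))) (fun t ht => by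
      have hs := HasDerivAt.fun_sum (u := Finset.univ)
        fun i _ => (di i t ht).const_mul (eps i * x i)
      refine (((dl t ht).sub ((hasDerivAt_id' t).mul hs)).sub ((hasDerivAt_pow 2 t).mul
        ((d0 t ht).const_mul _))).congr_deriv ?_
      have : ∑ i, eps i * x i * -(x i * h t (iFirst p q)) =
          -((∑ i, eps i * x i ^ 2) * h t (iFirst p q)) := by
        rw [Finset.sum_mul, ← Finset.sum_neg_distrib]
        exact Finset.sum_congr rfl fun i _ => by ring
      rw [this]
      norm_num
      ring)
    have h3 : ∑ i, eps i * x i * h 1 (iMid i) = ∑ i, eps i * x i * h 0 (iMid i) -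
        (∑ i, eps i * x i ^ 2) * h 0 (iFirst p q) := by
      rw [Finset.sum_mul, ← Finset.sum_sub_distrib]
      exact Finset.sum_congr rfl fun i _ => by rw [ei]; ring
    simp only [e0, h3] at this
    linarith
  funext a
  rcases a with a | a | a
  · obtain rfl : a = 0 := Subsingleton.elim _ _
    simp [stdBasis, Finset.sum_apply, e0]
  · simp [stdBasis, Finset.sum_apply, Pi.single_apply, ei]
    ring
  · obtain rfl : a = 0 := Subsingleton.elim _ _
    simp [stdBasis, Finset.sum_apply, el]
    simp only [mul_comm, mul_left_comm]
    ring

/-! ### Evaluation of tractors at a point of the fibre -/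

namespace CartanGeometry

variable {p q : ℕ} {M : Type*} [TopologicalSpace M]
  [ChartedSpace (EuclideanSpace ℝ (Fin (p + q))) M]
  {E : Type*} [NormedAddCommGroup E] [NormedSpace ℝ E]
  {B : Type*} [TopologicalSpace B] [ChartedSpace E B]
  [IsManifold 𝓘(ℝ, E) ∞ B] [MulAction (Parabolic p q)ᵐᵒᵖ B]
  {C : CartanGeometry p q M (E := E) B}

theorem tractorClass_self {x : M} (u : {u : B // C.proj u = x}) (v : StdRep p q) :
    (C.tractorClass u v).1 u = v := by
  rw [C.tractorClass_apply u u v 1 (by simp)]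
  simp [pMat]

/-- `P` acts transitively on the fibre of `B`, so equivariance propagates one value to all others.
-/
theorem TractorFiber.ext_at {x : M} (u : {u : B // C.proj u = x}) {f g : C.TractorFiber x}
    (h : f.1 u = g.1 u) : f = g := by
  apply Subtype.ext
  funext u'
  obtain ⟨b, hb⟩ := C.act_transitive u.1 u'.1 (u'.2.trans u.2.symm)
  rw [f.2 u u' b hb, g.2 u u' b hb, h]

theorem TractorSection.toFun_apply {U : Set M} (s : C.TractorSection U) {x : U}
    (u : {u : B // C.proj u = (x : M)}) : s.toFun u.1 = (s x).1 u := by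
  obtain ⟨x, hx⟩ := x
  obtain ⟨u, hu⟩ := u
  obtain rfl : C.proj u = x := hu
  exact dif_pos hx

end CartanGeometry
end ConformalTractor

theorem mainTheorem8 (p q : ℕ) (hn : 3 ≤ p + q)
    {M : Type*} [TopologicalSpace M] [T2Space M]
    [ChartedSpace (EuclideanSpace ℝ (Fin (p + q))) M] [IsManifold (𝓡 (p + q)) ∞ M]
    (c : ConformalStructure p q M)
    {E : Type*} [NormedAddCommGroup E] [NormedSpace ℝ E]
    {B : Type*} [TopologicalSpace B] [T2Space B] [ChartedSpace E B]
    [IsManifold 𝓘(ℝ, E) ∞ B] [MulAction (Parabolic p q)ᵐᵒᵖ B]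
    (C : CartanGeometry p q M (E := E) B) (hC : C.IsNormalConformal c)
    (u₀ : B) (N : C.NormalChart u₀)
    (s : C.TractorSection N.domain) (hs : s.IsParallel) :
    ∃ (k₀ : ℝ) (k : Fin (p + q) → ℝ) (k₁ : ℝ), ∀ x : N.domain,
      s x = k₀ • N.tildeFirst x + ∑ i, k i • N.tildeMid i x + k₁ • N.tildeLast x := by
  set v := s.toFun u₀
  refine ⟨v (iFirst p q), fun i => v (iMid i), v (iLast p q), fun x => ?_⟩
  set X := N.chart (x : M)
  have hX : X ∈ N.chart.target := N.chart.map_source x.2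
  -- Star-shapedness keeps the whole flow line over `U`, where the section is parallel.
  have hmem : ∀ t ∈ Set.Icc (0 : ℝ) 1, t • X ∈ N.chart.target := fun t ht =>
    N.starConvex.smul_mem hX ht.1 ht.2
  obtain ⟨γ, hγ0, hγ⟩ := CartanGeometry.FlowsTo.exists_curve C (u₀ := u₀) (X := gNeg X.ofLp)
    (u := fun t => N.Φ (t • X)) (fun t ht => by
      rw [← gNeg_smul]
      exact N.flow _ (hmem t ht))
  have hU : ∀ t ∈ Set.Icc (0 : ℝ) 1, C.proj (γ t) ∈ N.domain := fun t ht => by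
    rw [(hγ t ht).1, N.proj_Φ _ (hmem t ht)]
    exact N.chart.map_target (hmem t ht)
  have hval := eq_exp_neg_negMat X.ofLp (fun t => s.toFun (γ t)) fun t ht =>
    hs.hasDerivAt N.chart.open_source (hU t ht) (hγ t ht).2
  simp only [hγ0, (hγ 1 (by simp)).1, one_smul] at hval
  have hσ : s.toFun (N.Φ X) = (s x).1 (N.normalSection x) := s.toFun_apply (N.normalSection x)
  rw [hσ] at hval
  -- At `σ(x) = Φ(X)` the frame element `s_a(x)` takes the value `e_a`, so the claim becomes the
  -- formula for `exp(-X) f(u₀)`.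
  refine CartanGeometry.TractorFiber.ext_at (N.normalSection x) (hval.trans ?_)
  simp [CartanGeometry.NormalChart.tildeFirst, CartanGeometry.NormalChart.tildeMid,
    CartanGeometry.NormalChart.tildeLast, CartanGeometry.NormalChart.frame,
    CartanGeometry.NormalChart.coord, CartanGeometry.tractorClass_self, Finset.sum_apply, X, v]
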